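/- **Setting.** Fix a domain $D$ and a function-free vocabulary containing the propositional symbols $\mathbf{true}$ and $\mathbf{false}$. A (four-valued) structure $I$ is identified with the set of domain literals $P(\bar d)$, $\neg P(\bar d)$ that it contains: an atom is inconsistent, true, false or unknown in $I$ according as both, only the positive, only the negative, or neither of its literals is in $I$; $\mathbf{true}$ and $\mathbf{false}$ have their fixed values, and formulas (whose quantifiers range over specified subsets of $D$) are evaluated in the standard four-valued way. $I'$ expands $I$ if $I\subseteq I'$. A partial structure is one without inconsistent atoms. A definition is a set of rules $\forall \bar x\in\bar D: P(\bar x)\leftarrow\varphi$ such that each domain atom is defined by at most one rule and $\mathbf{true},\mathbf{false}$ are not defined; the atoms that are not defined are open. A two-valued structure $I$ is a model of $\Delta$ if it is the well-founded model of $\Delta$ in $I|_{open(\Delta)}$, and $\Delta$ is total if its well-founded model is two-valued for each two-valued structure of $open(\Delta)$. Let $voc(\Delta)$ be the set of predicate symbols occurring in $\Delta$. Two definitions $\Delta,\Delta'$ are strongly $\Sigma$-equivalent if each model of one (over the vocabulary $\Sigma$ together with the symbols of that definition), restricted to $\Sigma$, expands in a unique way to a model of the other (over $\Sigma$ and the symbols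 of the other one). A direct justification over $\Delta$ of a defined literal $P(\bar d)$ (resp. $\neg P(\bar d)$) is a consistent non-empty set $S$ of domain literals in which the body, at $\bar d$, of the rule defining $P(\bar d)$ is true (resp. false). A justification over $\Delta$ is a directed graph $J$ on the domain literals such that the set $J(l)$ of children of each literal $l$ is empty or a direct justification of $l$. For a set $L$ of literals, $J_L$ is the subgraph of the nodes and edges reachable from $L$. $J$ justifies a set $L$ of defined literals if (a) $J(l)\neq\emptyset$ for each defined literal $l$ in $J_L$; (b) each infinite path in $J_L$ consists of negative literals from some point on; (c) the literals in $J_L$ form a consistent set. **Acceptable states.** Let $T$ be a propositional symbol, $\Delta$ a total definition and $I_{in}$ a partial structure. A tuple $\langle\Delta_g,\Delta_d,J,I\rangle$ of two definitions, a graph and a partial structure is an acceptable state of the theory $\{T,\Delta\}$ with input structure $I_{in}$ if 1. $\Delta_g\cup\Delta_d$, $\Delta_g$ and $\Delta_d$ are total, and $\Delta_g\cup\Delta_d$ is strongly $voc(\Delta)$-equivalent with $\Delta$; 2. no domain atom is defined in both $\Delta_g$ and $\Delta_d$; 3. $J$ is a justification over $\Delta_g\cup\Delta_d$; 4. $I$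 is an expansion of $I_{in}$; 5. $J$ justifies, over $\Delta_g\cup\Delta_d$, the set $L$ of the literals that are true in $I$ and defined in $\Delta_d$; 6. no literal in $J_L$ is false in $I$. **Theorem.** Let $\langle\Delta_g,\Delta_d,J,I\rangle$ be an acceptable state of the theory $\{T,\Delta\}$ with input structure $I_{in}$, such that $T$ is true in $I$ and the restriction $I|_{voc(\Delta_g)}$ of $I$ to the predicate symbols occurring in $\Delta_g$ is a (two-valued) model of $\Delta_g$. Then there is a model $M$ of $\{T,\Delta\}$, that is, a two-valued structure of the whole vocabulary that is a model of $\Delta$ and in which $T$ is true, such that $M$ expands $I|_{voc(\Delta_g)}$. -/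

import Mathlib

namespace LazyGrounding

universe u v

/-- A function-free vocabulary: predicate symbols with arities, among them the two distinct
propositional symbols `top` (written "true") and `bot` (written "false"). -/
structure Vocabulary where
  Pred : Type u
  arity : Pred → ℕ
  top : Pred
  bot : Pred
  arity_top : arity top = 0
  arity_bot : arity bot = 0
  top_ne_bot : top ≠ bot

variable {V : Vocabulary.{u}} {D : Type v}

/-- Domain atoms `P(d₁, …, dₙ)` over the domain `D`. -/
structure DomAtom (V : Vocabulary.{u}) (D : Type v) where
  pred : V.Pred
  args : Fin (V.arity pred) → D

/-- The domain atom of a propositional symbol. -/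
def propAtom (P : V.Pred) (h : V.arity P = 0) : DomAtom V D :=
  ⟨P, fun i => Fin.elim0 (Fin.cast h i)⟩

/-- Domain literals; `sign = true` for the atom itself and `sign = false` for its negation.
A four-valued structure with domain `D` is identified with the set of domain literals it makes
true: an atom `a` is inconsistent if both `a` and `¬ a` belong to the set, true (false) if only
`a` (only `¬ a`) belongs to it, and unknown if neither does. Expansion (being at least as precise)
is inclusion of sets. -/
structure DomLit (V : Vocabulary.{u}) (D : Type v) where
  atom : DomAtom V D
  sign : Bool

def pos (a : DomAtom V D) : DomLit V D := ⟨a, true⟩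

def neg (a : DomAtom V D) : DomLit V D := ⟨a, false⟩

def DomLit.compl (l : DomLit V D) : DomLit V D := ⟨l.atom, !l.sign⟩

/-- The literals fixed by the interpretation of the symbols "true" and "false". -/
def constLits (V : Vocabulary.{u}) (D : Type v) : Set (DomLit V D) :=
  {pos (propAtom V.top V.arity_top), neg (propAtom V.bot V.arity_bot)}

/-- No atom occurs both positively and negatively. -/
def Consistent (S : Set (DomLit V D)) : Prop :=
  ∀ l ∈ S, l.compl ∉ S

/-- Partial (three-valued) structures over the whole vocabulary. -/
def IsPartialStructure (I : Set (DomLit V D)) : Prop :=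
  Consistent I ∧ constLits V D ⊆ I

/-- Restriction of a structure to a set of domain atoms. -/
def restrict (I : Set (DomLit V D)) (A : Set (DomAtom V D)) : Set (DomLit V D) :=
  {l ∈ I | l.atom ∈ A}

/-- The domain atoms of the predicate symbols in `σ`. -/
def atomsOf (D : Type v) (σ : Set V.Pred) : Set (DomAtom V D) :=
  {a | a.pred ∈ σ}

/-- `I` is a two-valued structure of the set `A` of domain atoms: each atom of `A` is either true
or false in `I`, all other atoms are unknown, and "true", "false" have their fixed meaning. -/
def IsTwoValuedOn (A : Set (DomAtom V D)) (I : Set (DomLit V D)) : Prop :=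
  (∀ l ∈ I, l.atom ∈ A) ∧
  (∀ a ∈ A, (pos a ∈ I ∧ neg a ∉ I) ∨ (neg a ∈ I ∧ pos a ∉ I)) ∧
  restrict (constLits V D) A ⊆ I

/-- Formulas with free variables `0, …, n - 1`; terms are variables or domain elements.
A quantifier ranges over a specified subset `D'` of the domain and binds the variable `n`. -/
inductive Formula (V : Vocabulary.{u}) (D : Type v) : ℕ → Type (max u v)
  | atom {n : ℕ} (P : V.Pred) (ts : Fin (V.arity P) → Fin n ⊕ D) : Formula V D n
  | not {n : ℕ} (φ : Formula V D n) : Formula V D n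
  | and {n : ℕ} (φ ψ : Formula V D n) : Formula V D n
  | or {n : ℕ} (φ ψ : Formula V D n) : Formula V D n
  | ex {n : ℕ} (D' : Set D) (φ : Formula V D (n + 1)) : Formula V D n
  | all {n : ℕ} (D' : Set D) (φ : Formula V D (n + 1)) : Formula V D n

/-- `φ.Supports I b d`: the structure `I` supports the truth (`b = true`), respectively the
falsity (`b = false`), of `φ[x/d]`. The four-valued truth value of `φ[x/d]` in `I` is true
(false) if only its truth (falsity) is supported, inconsistent if both are, and unknown if neither
is; in this coding the clauses are minimum and maximum in the truth order. -/
def Formula.Supports (I : Set (DomLit V D)) :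
    {n : ℕ} → Formula V D n → Bool → (Fin n → D) → Prop
  | _, .atom P ts, b, d =>
      (⟨⟨P, fun i => Sum.elim d id (ts i)⟩, b⟩ : DomLit V D) ∈ I ∪ constLits V D
  | _, .not φ, b, d => φ.Supports I (!b) d
  | _, .and φ ψ, true, d => φ.Supports I true d ∧ ψ.Supports I true d
  | _, .and φ ψ, false, d => φ.Supports I false d ∨ ψ.Supports I false d
  | _, .or φ ψ, true, d => φ.Supports I true d ∨ ψ.Supports I true d
  | _, .or φ ψ, false, d => φ.Supports I false d ∧ ψ.Supports I false d
  | n, .ex D' φ, true, d => ∃ e ∈ D', φ.Supports I true (Fin.snoc (α := fun _ : Fin (n + 1) => D) d e)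
  | n, .ex D' φ, false, d => ∀ e ∈ D', φ.Supports I false (Fin.snoc (α := fun _ : Fin (n + 1) => D) d e)
  | n, .all D' φ, true, d => ∀ e ∈ D', φ.Supports I true (Fin.snoc (α := fun _ : Fin (n + 1) => D) d e)
  | n, .all D' φ, false, d => ∃ e ∈ D', φ.Supports I false (Fin.snoc (α := fun _ : Fin (n + 1) => D) d e)

/-- The truth value of `φ[x/d]` in `I` is true (for `b = true`), respectively false. -/
def Formula.HasValue {n : ℕ} (φ : Formula V D n) (I : Set (DomLit V D)) (b : Bool)
    (d : Fin n → D) : Prop :=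
  φ.Supports I b d ∧ ¬ φ.Supports I (!b) d

/-- The predicate symbols that occur in a formula. -/
def Formula.voc : {n : ℕ} → Formula V D n → Set V.Pred
  | _, .atom P _ => {P}
  | _, .not φ => φ.voc
  | _, .and φ ψ => φ.voc ∪ ψ.voc
  | _, .or φ ψ => φ.voc ∪ ψ.voc
  | _, .ex _ φ => φ.voc
  | _, .all _ φ => φ.voc

/-- A rule `∀ x ∈ dom : P(x) ← body`. -/
structure Rule (V : Vocabulary.{u}) (D : Type v) where
  pred : V.Pred
  dom : Set (Fin (V.arity pred) → D)
  body : Formula V D (V.arity pred)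

/-- A set of rules is a definition if each domain atom is defined by at most one rule and
the symbols "true" and "false" are not defined. -/
def IsDefinition (Δ : Set (Rule V D)) : Prop :=
  (∀ r ∈ Δ, ∀ r' ∈ Δ, ∀ a : DomAtom V D,
    (∃ d ∈ r.dom, a = ⟨r.pred, d⟩) → (∃ d ∈ r'.dom, a = ⟨r'.pred, d⟩) → r = r') ∧
  ∀ r ∈ Δ, r.pred ≠ V.top ∧ r.pred ≠ V.bot

/-- The domain atoms defined by `Δ`. -/
def definedAtoms (Δ : Set (Rule V D)) : Set (DomAtom V D) :=
  {a | ∃ r ∈ Δ, ∃ d ∈ r.dom, a = ⟨r.pred, d⟩}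

/-- The domain atoms that are open in `Δ`. -/
def openAtoms (Δ : Set (Rule V D)) : Set (DomAtom V D) :=
  (definedAtoms Δ)ᶜ

/-- The predicate symbols that occur in `Δ`. -/
def voc (Δ : Set (Rule V D)) : Set V.Pred :=
  {P | ∃ r ∈ Δ, P = r.pred ∨ P ∈ r.body.voc}

/-- `W` contains the open part `O` and is closed under the two well-founded inferences: a defined
atom whose body is supported becomes true; all atoms of an unfounded set `U` (the bodies of the
atoms of `U` are false once all atoms of `U` are assumed false) become false. -/
def WFClosed (Δ : Set (Rule V D)) (O W : Set (DomLit V D)) : Prop :=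
  O ⊆ W ∧
  (∀ r ∈ Δ, ∀ d ∈ r.dom, r.body.Supports W true d → pos ⟨r.pred, d⟩ ∈ W) ∧
  (∀ U ⊆ definedAtoms Δ,
    (∀ r ∈ Δ, ∀ d ∈ r.dom, (⟨r.pred, d⟩ : DomAtom V D) ∈ U →
      r.body.Supports (W ∪ neg '' U) false d) →
    neg '' U ⊆ W)

/-- The (in general three-valued) well-founded model of `Δ` in the structure `O` of the open
atoms: the least set of literals closed under the well-founded inferences. -/
def wellFoundedModel (Δ : Set (Rule V D)) (O : Set (DomLit V D)) : Set (DomLit V D) :=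
  ⋂₀ {W | WFClosed Δ O W}

/-- `I` is a model of the definition `Δ`, as a structure of the vocabulary `σ ⊇ voc Δ`. -/
def IsModel (σ : Set V.Pred) (Δ : Set (Rule V D)) (I : Set (DomLit V D)) : Prop :=
  IsTwoValuedOn (atomsOf D σ) I ∧ I = wellFoundedModel Δ (restrict I (openAtoms Δ))

/-- `M` is a model, over the whole vocabulary, of the theory `{T, Δ}`. -/
def IsTheoryModel (T : V.Pred) (hT : V.arity T = 0) (Δ : Set (Rule V D))
    (M : Set (DomLit V D)) : Prop :=
  IsModel Set.univ Δ M ∧ pos (propAtom T hT) ∈ M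

/-- `Δ` is total: its well-founded model in each two-valued structure of its open atoms is
two-valued. -/
def IsTotal (Δ : Set (Rule V D)) : Prop :=
  ∀ O : Set (DomLit V D), IsTwoValuedOn (openAtoms Δ) O →
    IsTwoValuedOn Set.univ (wellFoundedModel Δ O)

/-- Each model of `Δ`, restricted to `σ`, expands in a unique way to a model of `Δ'`. -/
def UniquelyExpands (σ : Set V.Pred) (Δ Δ' : Set (Rule V D)) : Prop :=
  ∀ M, IsModel (σ ∪ voc Δ) Δ M →
    ∃! M', IsModel (σ ∪ voc Δ') Δ' M' ∧ restrict M (atomsOf D σ) ⊆ M'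

/-- Strong `σ`-equivalence of definitions. -/
def StronglyEquivalent (σ : Set V.Pred) (Δ Δ' : Set (Rule V D)) : Prop :=
  UniquelyExpands σ Δ Δ' ∧ UniquelyExpands σ Δ' Δ

/-- `S` is a direct justification, over `Δ`, of the defined literal `l`. -/
def IsDirectJustification (Δ : Set (Rule V D)) (l : DomLit V D) (S : Set (DomLit V D)) : Prop :=
  S.Nonempty ∧ Consistent S ∧
  ∃ r ∈ Δ, ∃ d ∈ r.dom, l.atom = ⟨r.pred, d⟩ ∧ r.body.HasValue S l.sign d

/-- `J` (a graph on the domain literals, given by its sets of children) is a justification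
over `Δ`. -/
def IsJustification (Δ : Set (Rule V D)) (J : DomLit V D → Set (DomLit V D)) : Prop :=
  ∀ l, J l = ∅ ∨ IsDirectJustification Δ l (J l)

/-- The nodes of the subgraph `J_L`: the literals reachable in `J` from a literal of `L`. -/
def reach (J : DomLit V D → Set (DomLit V D)) (L : Set (DomLit V D)) : Set (DomLit V D) :=
  {m | ∃ l ∈ L, Relation.ReflTransGen (fun a b => b ∈ J a) l m}

/-- Every infinite path in `J` that starts in a literal reachable from `l` is negative from some
point on. -/
def WellFoundedIn (J : DomLit V D → Set (DomLit V D)) (l : DomLit V D) : Prop :=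
  ∀ p : ℕ → DomLit V D, p 0 ∈ reach J {l} → (∀ n, p (n + 1) ∈ J (p n)) →
    ∃ N, ∀ n ≥ N, (p n).sign = false

/-- `J` justifies, over `Δ`, the set `L` of literals defined in `Δ`. -/
structure Justifies (Δ : Set (Rule V D)) (J : DomLit V D → Set (DomLit V D))
    (L : Set (DomLit V D)) : Prop where
  defined : ∀ l ∈ L, l.atom ∈ definedAtoms Δ
  total : ∀ l ∈ reach J L, l.atom ∈ definedAtoms Δ → (J l).Nonempty
  wellFounded : ∀ l ∈ L, WellFoundedIn J l
  consistent : Consistent (reach J L)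

/-- The literals true in `I` and defined in `Δ`. -/
def trueDefined (Δ : Set (Rule V D)) (I : Set (DomLit V D)) : Set (DomLit V D) :=
  {l | l ∈ I ∧ l.compl ∉ I ∧ l.atom ∈ definedAtoms Δ}

/-- `⟨Δg, Δd, J, I⟩` is an acceptable state for the definition `Δ` and the input structure
`Iin`. -/
structure IsAcceptable (Δ : Set (Rule V D)) (Iin : Set (DomLit V D))
    (Δg Δd : Set (Rule V D)) (J : DomLit V D → Set (DomLit V D)) (I : Set (DomLit V D)) :
    Prop where
  isDefinition_ground : IsDefinition Δg
  isDefinition_delayed : IsDefinition Δd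
  isTotal_union : IsTotal (Δg ∪ Δd)
  isTotal_ground : IsTotal Δg
  isTotal_delayed : IsTotal Δd
  equivalent : StronglyEquivalent (voc Δ) (Δg ∪ Δd) Δ
  disjoint : Disjoint (definedAtoms Δg) (definedAtoms Δd)
  isJustification : IsJustification (Δg ∪ Δd) J
  isPartialStructure : IsPartialStructure I
  expands : Iin ⊆ I
  justifies : Justifies (Δg ∪ Δd) J (trueDefined Δd I)
  /-- No literal of the justification of the true delayed literals is false in `I`. -/
  consistent : ∀ l ∈ reach J (trueDefined Δd I), l.compl ∉ I

end LazyGrounding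

/-!
The model is the well-founded model `N` of `Δg ∪ Δd` in a two-valued structure of the open atoms
that agrees with `I` and with the justification `J_L` of the set `L` of true delayed literals. Such
a structure exists because `I ∪ J_L` is consistent.

* Every literal of `J_L` belongs to `N`
  (`LazyGrounding.Justifies.reach_subset_of_wfClosed`): a literal all of whose positive descendants
  belong to `N` belongs to `N` itself, because its negative descendants form an unfounded set; and a
  descent through positive literals outside `N` would yield an infinite path that is not eventually
  negative.
* Hence the literals of `I` that are open in `Δg` belong to `N`. As `Δg` and `Δd` define different
  atoms, `N` is closed under the well-founded inferences of `Δg`, and so it contains the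
  well-founded model `I|voc(Δg)` of `Δg`. In the same way `T` is true in `N`.
* The well-founded model commutes with restriction to a vocabulary containing the symbols of the
  definition (`LazyGrounding.wellFoundedModel_restrict`). So `N`, restricted to the symbols in
  question, is a model of `Δg ∪ Δd`, and by strong equivalence its restriction to `voc(Δ)` is a
  model of `Δ`. The other symbols are open in `Δ`, so `N` itself is a model of `Δ`.
-/

namespace LazyGrounding

universe u v

variable {V : Vocabulary.{u}} {D : Type v}

/-! ### Monotonicity and locality of support -/

theorem Formula.Supports.mono {I I' : Set (DomLit V D)} (h : I ⊆ I') {n : ℕ}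
    {φ : Formula V D n} {b : Bool} {d : Fin n → D} (hφ : φ.Supports I b d) :
    φ.Supports I' b d := by
  induction φ generalizing b with
  | atom P ts => exact Set.union_subset_union_left _ h hφ
  | not φ ih => exact ih hφ
  | and φ ψ ih₁ ih₂ =>
    cases b
    · exact hφ.imp ih₁ ih₂
    · exact hφ.imp ih₁ ih₂
  | or φ ψ ih₁ ih₂ =>
    cases b
    · exact hφ.imp ih₁ ih₂
    · exact hφ.imp ih₁ ih₂
  | ex D' φ ih =>
    cases b
    · exact fun e he => ih (hφ e he)
    · exact hφ.imp fun e he => ⟨he.1, ih he.2⟩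
  | all D' φ ih =>
    cases b
    · exact hφ.imp fun e he => ⟨he.1, ih he.2⟩
    · exact fun e he => ih (hφ e he)

/-- Support of a formula depends only on the literals over its own predicate symbols. -/
theorem Formula.Supports.of_voc_subset {σ : Set V.Pred} {I : Set (DomLit V D)} {n : ℕ}
    {φ : Formula V D n} {b : Bool} {d : Fin n → D} (hσ : φ.voc ⊆ σ) (hφ : φ.Supports I b d) :
    φ.Supports (restrict I (atomsOf D σ)) b d := by
  induction φ generalizing b with
  | atom P ts =>
    rcases hφ with h | h
    · exact Or.inl ⟨h, hσ rfl⟩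
    · exact Or.inr h
  | not φ ih => exact ih hσ hφ
  | and φ ψ ih₁ ih₂ =>
    obtain ⟨h₁, h₂⟩ := Set.union_subset_iff.1 hσ
    cases b
    · exact hφ.imp (ih₁ h₁) (ih₂ h₂)
    · exact hφ.imp (ih₁ h₁) (ih₂ h₂)
  | or φ ψ ih₁ ih₂ =>
    obtain ⟨h₁, h₂⟩ := Set.union_subset_iff.1 hσ
    cases b
    · exact hφ.imp (ih₁ h₁) (ih₂ h₂)
    · exact hφ.imp (ih₁ h₁) (ih₂ h₂)
  | ex D' φ ih =>
    cases b
    · exact fun e he => ih hσ (hφ e he)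
    · exact hφ.imp fun e he => ⟨he.1, ih hσ he.2⟩
  | all D' φ ih =>
    cases b
    · exact hφ.imp fun e he => ⟨he.1, ih hσ he.2⟩
    · exact fun e he => ih hσ (hφ e he)

/-! ### Two-valued structures -/

theorem IsTwoValuedOn.restrict {A B : Set (DomAtom V D)} {I : Set (DomLit V D)} (hBA : B ⊆ A)
    (hI : IsTwoValuedOn A I) : IsTwoValuedOn B (restrict I B) := by
  refine ⟨fun l hl => hl.2, fun a ha => ?_, fun l hl => ⟨hI.2.2 ⟨hl.1, hBA hl.2⟩, hl.2⟩⟩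
  rcases hI.2.1 a (hBA ha) with h | h
  · exact Or.inl ⟨⟨h.1, ha⟩, fun h' => h.2 h'.1⟩
  · exact Or.inr ⟨⟨h.1, ha⟩, fun h' => h.2 h'.1⟩

/-- Two-valued structures of the same atoms are incomparable unless they are equal. -/
theorem IsTwoValuedOn.eq_of_subset {A : Set (DomAtom V D)} {I K : Set (DomLit V D)}
    (hI : IsTwoValuedOn A I) (hK : IsTwoValuedOn A K) (h : I ⊆ K) : I = K := by
  refine h.antisymm fun l hl => ?_
  obtain ⟨a, s⟩ := l
  rcases hI.2.1 a (hK.1 _ hl) with h₁ | h₁ <;> rcases hK.2.1 a (hK.1 _ hl) with h₂ | h₂ <;> cases s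
  · exact absurd hl h₂.2
  · exact h₁.1
  · exact absurd (h h₁.1) h₂.2
  · exact h₁.1
  · exact h₁.1
  · exact absurd (h h₁.1) h₂.2
  · exact h₁.1
  · exact absurd hl h₂.2

theorem exists_isTwoValuedOn_of_consistent (A : Set (DomAtom V D)) {C : Set (DomLit V D)}
    (hC : Consistent C) (hconst : constLits V D ⊆ C) :
    ∃ O, IsTwoValuedOn A O ∧ restrict C A ⊆ O := by
  -- The atoms undecided by `C` are made false.
  have key : restrict C A ⊆ {l | l.atom ∈ A ∧ (l.sign = true ↔ pos l.atom ∈ C)} := by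
    rintro ⟨a, s⟩ ⟨hl, ha⟩
    cases s
    · exact ⟨ha, iff_of_false Bool.false_ne_true (hC _ hl)⟩
    · exact ⟨ha, iff_of_true rfl hl⟩
  refine ⟨_, ⟨fun l hl => hl.1, fun a ha => ?_, fun l hl => key ⟨hconst hl.1, hl.2⟩⟩, key⟩
  by_cases h : pos a ∈ C
  · exact Or.inl ⟨⟨ha, iff_of_true rfl h⟩, fun h' => Bool.false_ne_true (h'.2.2 h)⟩
  · exact Or.inr ⟨⟨ha, iff_of_false Bool.false_ne_true h⟩, fun h' => h (h'.2.1 rfl)⟩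

/-! ### The well-founded model -/

theorem definedAtoms_subset_atomsOf_voc (Δ : Set (Rule V D)) :
    definedAtoms Δ ⊆ atomsOf D (voc Δ) := by
  rintro _ ⟨r, hr, d, -, rfl⟩
  exact ⟨r, hr, Or.inl rfl⟩

theorem wfClosed_wellFoundedModel (Δ : Set (Rule V D)) (O : Set (DomLit V D)) :
    WFClosed Δ O (wellFoundedModel Δ O) := by
  refine ⟨fun l hl W hW => hW.1 hl, fun r hr d hd hs W hW => ?_, fun U hU hs => ?_⟩
  · exact hW.2.1 r hr d hd (hs.mono (Set.sInter_subset_of_mem hW))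
  · refine Set.subset_sInter fun W hW => hW.2.2 U hU fun r hr d hd hrd => ?_
    exact (hs r hr d hd hrd).mono (Set.union_subset_union_left _ (Set.sInter_subset_of_mem hW))

/-- The well-founded model is local: it commutes with restriction to a vocabulary that contains
all symbols of the definition. -/
theorem wellFoundedModel_restrict {Δ : Set (Rule V D)} {σ : Set V.Pred} (hσ : voc Δ ⊆ σ)
    (O : Set (DomLit V D)) :
    wellFoundedModel Δ (restrict O (atomsOf D σ)) =
      restrict (wellFoundedModel Δ O) (atomsOf D σ) := by
  have hdef : definedAtoms Δ ⊆ atomsOf D σ :=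
    (definedAtoms_subset_atomsOf_voc Δ).trans fun a ha => hσ ha
  refine Set.Subset.antisymm (Set.sInter_subset_of_mem ?_) ?_
  · obtain ⟨hO, hpos, hneg⟩ := wfClosed_wellFoundedModel Δ O
    have hsub : restrict (wellFoundedModel Δ O) (atomsOf D σ) ⊆ wellFoundedModel Δ O :=
      fun l hl => hl.1
    refine ⟨fun l hl => ⟨hO hl.1, hl.2⟩, fun r hr d hd hs => ?_, fun U hU hs => ?_⟩
    · exact ⟨hpos r hr d hd (hs.mono hsub), hdef ⟨r, hr, d, hd, rfl⟩⟩
    · have := hneg U hU fun r hr d hd hrd =>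
        (hs r hr d hd hrd).mono (Set.union_subset_union_left _ hsub)
      rintro _ ⟨a, ha, rfl⟩
      exact ⟨this ⟨a, ha, rfl⟩, hdef (hU ha)⟩
  · -- A set closed for the restricted structure stays closed when all literals outside `σ` are
    -- added to it.
    rintro l ⟨hl, hlσ⟩ W ⟨hO, hpos, hneg⟩
    suffices h : WFClosed Δ O (W ∪ {m | m.atom ∉ atomsOf D σ}) from
      (hl _ h).resolve_right fun h' => h' hlσ
    have hbody : ∀ r ∈ Δ, r.body.voc ⊆ σ := fun r hr P hP => hσ ⟨r, hr, Or.inr hP⟩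
    refine ⟨fun m hm => ?_, fun r hr d hd hs => ?_, fun U hU hs => ?_⟩
    · by_cases h : m.atom ∈ atomsOf D σ
      · exact Or.inl (hO ⟨hm, h⟩)
      · exact Or.inr h
    · refine Or.inl (hpos r hr d hd ((hs.of_voc_subset (hbody r hr)).mono ?_))
      rintro m ⟨hm | hm, hmσ⟩
      · exact hm
      · exact absurd hmσ hm
    · refine (hneg U hU fun r hr d hd hrd => ?_).trans Set.subset_union_left
      refine ((hs r hr d hd hrd).of_voc_subset (hbody r hr)).mono ?_
      rintro m ⟨(hm | hm) | hm, hmσ⟩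
      · exact Or.inl hm
      · exact absurd hmσ hm
      · exact Or.inr hm

/-- A closed set for the union of two definitions of different atoms is closed for the first of
them, with any set of literals it contains in the role of the open part. -/
theorem WFClosed.of_union_left {Δ₁ Δ₂ : Set (Rule V D)} {O O' W : Set (DomLit V D)}
    (hdisj : Disjoint (definedAtoms Δ₁) (definedAtoms Δ₂)) (hW : WFClosed (Δ₁ ∪ Δ₂) O W)
    (hO' : O' ⊆ W) : WFClosed Δ₁ O' W := by
  refine ⟨hO', fun r hr => hW.2.1 r (Or.inl hr), fun U hU hs => hW.2.2 U ?_ ?_⟩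
  · intro a ha
    obtain ⟨r, hr, h⟩ := hU ha
    exact ⟨r, Or.inl hr, h⟩
  · rintro r (hr | hr) d hd hrd
    · exact hs r hr d hd hrd
    · exact absurd ⟨r, hr, d, hd, rfl⟩ (Set.disjoint_left.1 hdisj (hU hrd))

theorem restrict_openAtoms_wellFoundedModel {Δ : Set (Rule V D)} (htotal : IsTotal Δ)
    {O : Set (DomLit V D)} (hO : IsTwoValuedOn (openAtoms Δ) O) :
    restrict (wellFoundedModel Δ O) (openAtoms Δ) = O :=
  (hO.eq_of_subset ((htotal O hO).restrict (Set.subset_univ _)) fun l hl =>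
    ⟨(wfClosed_wellFoundedModel Δ O).1 hl, hO.1 l hl⟩).symm

theorem restrict_right_comm (I : Set (DomLit V D)) (A B : Set (DomAtom V D)) :
    restrict (restrict I A) B = restrict (restrict I B) A :=
  Set.ext fun _ => and_right_comm

theorem IsModel.restrict {Δ : Set (Rule V D)} {σ τ : Set V.Pred} {M : Set (DomLit V D)}
    (hM : IsModel τ Δ M) (hσ : voc Δ ⊆ σ) (hστ : σ ⊆ τ) :
    IsModel σ Δ (restrict M (atomsOf D σ)) := by
  refine ⟨hM.1.restrict fun a ha => hστ ha, ?_⟩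
  rw [restrict_right_comm, wellFoundedModel_restrict hσ, ← hM.2]

/-- A two-valued structure is a model of a total definition as soon as its restriction to the
symbols of the definition is: all other symbols are open. -/
theorem isModel_univ_of_restrict_voc {Δ : Set (Rule V D)} (htotal : IsTotal Δ)
    {N : Set (DomLit V D)} (hN : IsTwoValuedOn Set.univ N)
    (h : IsModel (voc Δ) Δ (restrict N (atomsOf D (voc Δ)))) : IsModel Set.univ Δ N := by
  refine ⟨hN, hN.eq_of_subset (htotal _ (hN.restrict (Set.subset_univ _))) fun l hl => ?_⟩
  by_cases hlv : l.atom ∈ atomsOf D (voc Δ)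
  · have hmem : l ∈ restrict N (atomsOf D (voc Δ)) := ⟨hl, hlv⟩
    rw [h.2, restrict_right_comm, wellFoundedModel_restrict subset_rfl] at hmem
    exact hmem.1
  · exact (wfClosed_wellFoundedModel Δ _).1
      ⟨hl, fun hd => hlv (definedAtoms_subset_atomsOf_voc Δ hd)⟩

/-! ### Justified literals belong to the well-founded model -/

theorem IsDefinition.union {Δ₁ Δ₂ : Set (Rule V D)} (h₁ : IsDefinition Δ₁)
    (h₂ : IsDefinition Δ₂) (hdisj : Disjoint (definedAtoms Δ₁) (definedAtoms Δ₂)) :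
    IsDefinition (Δ₁ ∪ Δ₂) := by
  refine ⟨?_, fun r hr => hr.elim (h₁.2 r) (h₂.2 r)⟩
  rintro r (hr | hr) r' (hr' | hr') a ha ha'
  · exact h₁.1 r hr r' hr' a ha ha'
  · exact absurd ⟨r', hr', ha'⟩ (Set.disjoint_left.1 hdisj ⟨r, hr, ha⟩)
  · exact absurd ⟨r, hr, ha⟩ (Set.disjoint_left.1 hdisj ⟨r', hr', ha'⟩)
  · exact h₂.1 r hr r' hr' a ha ha'

theorem IsDefinition.supports_of_isDirectJustification {Δ : Set (Rule V D)} (hΔ : IsDefinition Δ)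
    {l : DomLit V D} {S : Set (DomLit V D)} (hS : IsDirectJustification Δ l S) {r : Rule V D}
    (hr : r ∈ Δ) {d : Fin (V.arity r.pred) → D} (hd : d ∈ r.dom) (hl : l.atom = ⟨r.pred, d⟩) :
    r.body.Supports S l.sign d := by
  obtain ⟨-, -, r', hr', d', hd', hl', hs, -⟩ := hS
  obtain rfl := hΔ.1 r hr r' hr' _ ⟨d, hd, hl⟩ ⟨d', hd', hl'⟩
  rw [hl, DomAtom.mk.injEq] at hl'
  obtain rfl := eq_of_heq hl'.2
  exact hs

/-- A literal belongs to a closed set if every positive literal properly below it in the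
justification does: the negative literals below it then form an unfounded set. -/
theorem mem_of_forall_pos_transGen_mem {Δ : Set (Rule V D)} (hΔ : IsDefinition Δ)
    {O W : Set (DomLit V D)} (hW : WFClosed Δ O W) {J : DomLit V D → Set (DomLit V D)}
    (hJ : IsJustification Δ J) {l : DomLit V D}
    (htotal : ∀ m, Relation.ReflTransGen (fun a b => b ∈ J a) l m →
      m.atom ∈ definedAtoms Δ → (J m).Nonempty)
    (hopen : ∀ m, Relation.ReflTransGen (fun a b => b ∈ J a) l m → m.atom ∈ openAtoms Δ → m ∈ W)
    (hpos : ∀ m, Relation.TransGen (fun a b => b ∈ J a) l m → m.sign = true → m ∈ W) :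
    l ∈ W := by
  have hdj : ∀ m, Relation.ReflTransGen (fun a b => b ∈ J a) l m →
      m.atom ∈ definedAtoms Δ → IsDirectJustification Δ m (J m) := fun m hm hmd =>
    (hJ m).resolve_left (htotal m hm hmd).ne_empty
  let U : Set (DomAtom V D) :=
    {a | a ∈ definedAtoms Δ ∧ Relation.ReflTransGen (fun a b => b ∈ J a) l (neg a)}
  have hchild : ∀ m, Relation.ReflTransGen (fun a b => b ∈ J a) l m → J m ⊆ W ∪ neg '' U := by
    rintro m hm ⟨a, s⟩ hk
    by_cases hd : a ∈ definedAtoms Δ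
    · cases s
      · exact Or.inr ⟨a, ⟨hd, hm.tail hk⟩, rfl⟩
      · exact Or.inl (hpos _ (Relation.TransGen.tail' hm hk) rfl)
    · exact Or.inl (hopen _ (hm.tail hk) hd)
  have hU : neg '' U ⊆ W := hW.2.2 U (fun a ha => ha.1) fun r hr d hd hrd =>
    (hΔ.supports_of_isDirectJustification (hdj _ hrd.2 hrd.1) hr hd rfl).mono (hchild _ hrd.2)
  obtain ⟨a, s⟩ := l
  by_cases hd : a ∈ definedAtoms Δ
  · cases s
    · exact hU ⟨a, ⟨hd, .refl⟩, rfl⟩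
    · have hj := hdj _ .refl hd
      obtain ⟨r, hr, d, hrd, rfl⟩ := hd
      refine hW.2.1 r hr d hrd
        ((hΔ.supports_of_isDirectJustification hj hr hrd rfl).mono ?_)
      exact (hchild _ .refl).trans (Set.union_subset subset_rfl hU)
  · exact hopen _ .refl hd

/-- `StepsTo J B n l`: there is a path of length `n + 1` in `J` from `l` to a node of `B`. -/
def StepsTo (J : DomLit V D → Set (DomLit V D)) (B : Set (DomLit V D)) :
    ℕ → DomLit V D → Prop
  | 0, l => ∃ m ∈ J l, m ∈ B
  | n + 1, l => ∃ m ∈ J l, StepsTo J B n m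

theorem exists_stepsTo_of_transGen {J : DomLit V D → Set (DomLit V D)} {B : Set (DomLit V D)}
    {l m : DomLit V D} (h : Relation.TransGen (fun a b => b ∈ J a) l m) (hm : m ∈ B) :
    ∃ n, StepsTo J B n l := by
  induction h using Relation.TransGen.head_induction_on with
  | single h => exact ⟨0, _, h, hm⟩
  | head h _ ih =>
    obtain ⟨n, hn⟩ := ih
    exact ⟨n + 1, _, h, hn⟩

/-- If every node of `B` has a proper descendant in `B`, then from each node of `B` there starts an
infinite path that meets `B` infinitely often. -/
theorem exists_path_frequently_mem {J : DomLit V D → Set (DomLit V D)} {B : Set (DomLit V D)}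
    (hB : ∀ l ∈ B, ∃ m ∈ B, Relation.TransGen (fun a b => b ∈ J a) l m) {l : DomLit V D}
    (hl : l ∈ B) :
    ∃ p : ℕ → DomLit V D, p 0 = l ∧ (∀ n, p (n + 1) ∈ J (p n)) ∧ ∀ N, ∃ n ≥ N, p n ∈ B := by
  have hB' : ∀ l ∈ B, ∃ n, StepsTo J B n l := fun l hl =>
    let ⟨_, hm, h⟩ := hB l hl
    exists_stepsTo_of_transGen h hm
  -- The states are nodes with a countdown to the next visit of `B`.
  let State := {s : ℕ × DomLit V D // StepsTo J B s.1 s.2}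
  have hnext : ∀ s : State, ∃ t : State, t.1.2 ∈ J s.1.2 ∧
      (s.1.1 = 0 → t.1.2 ∈ B) ∧ ∀ k, s.1.1 = k + 1 → t.1.1 = k := by
    rintro ⟨⟨k, x⟩, hs⟩
    cases k with
    | zero =>
      obtain ⟨m, hm, hmB⟩ := hs
      obtain ⟨n, hn⟩ := hB' m hmB
      exact ⟨⟨(n, m), hn⟩, hm, fun _ => hmB, fun k hk => absurd hk.symm k.succ_ne_zero⟩
    | succ k =>
      obtain ⟨m, hm, hn⟩ := hs
      exact ⟨⟨(k, m), hn⟩, hm, fun h => absurd h k.succ_ne_zero, fun j hj => Nat.succ.inj hj⟩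
  choose next hJ hzero hsucc using hnext
  obtain ⟨n₀, hn₀⟩ := hB' l hl
  let s : ℕ → State := fun n => next^[n] ⟨(n₀, l), hn₀⟩
  have hs : ∀ n, s (n + 1) = next (s n) := fun n => Function.iterate_succ_apply' _ _ _
  have hvisit : ∀ k n, (s n).1.1 = k → (s (n + k + 1)).1.2 ∈ B := by
    intro k
    induction k with
    | zero =>
      intro n hn
      rw [add_zero, hs]
      exact hzero _ hn
    | succ k ih =>
      intro n hn
      have := ih (n + 1) (by rw [hs]; exact hsucc _ k hn)
      rwa [show n + (k + 1) + 1 = n + 1 + k + 1 by omega]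
  refine ⟨fun n => (s n).1.2, rfl, fun n => ?_, fun N => ⟨_, ?_, hvisit _ N rfl⟩⟩
  · change (s (n + 1)).1.2 ∈ J (s n).1.2
    rw [hs]
    exact hJ _
  · omega

/-- A set that is closed under the well-founded inferences and contains the open literals of the
subgraph `J_L` of a justified set `L` contains all of `J_L`. -/
theorem Justifies.reach_subset_of_wfClosed {Δ : Set (Rule V D)} (hΔ : IsDefinition Δ)
    {O W : Set (DomLit V D)} (hW : WFClosed Δ O W) {J : DomLit V D → Set (DomLit V D)}
    (hJ : IsJustification Δ J) {L : Set (DomLit V D)} (hL : Justifies Δ J L)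
    (hopen : ∀ m ∈ reach J L, m.atom ∈ openAtoms Δ → m ∈ W) : reach J L ⊆ W := by
  rintro m ⟨l, hl, hlm⟩
  have hstep : ∀ k, Relation.ReflTransGen (fun a b => b ∈ J a) l k → k ∉ W →
      ∃ q, Relation.TransGen (fun a b => b ∈ J a) k q ∧ q.sign = true ∧ q ∉ W := by
    intro k hk hkW
    by_contra! h
    exact hkW (mem_of_forall_pos_transGen_mem hΔ hW hJ
      (fun q hq => hL.total q ⟨l, hl, hk.trans hq⟩)
      (fun q hq => hopen q ⟨l, hl, hk.trans hq⟩) h)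
  by_contra hm
  let B : Set (DomLit V D) :=
    {k | Relation.ReflTransGen (fun a b => b ∈ J a) l k ∧ k.sign = true ∧ k ∉ W}
  obtain ⟨q, hmq, hq⟩ := hstep m hlm hm
  obtain ⟨p, hp0, hpJ, hpB⟩ := exists_path_frequently_mem (J := J) (B := B) (l := q)
    (fun k hk =>
      let ⟨q, hkq, hq⟩ := hstep k hk.1 hk.2.2
      ⟨q, ⟨hk.1.trans hkq.to_reflTransGen, hq⟩, hkq⟩)
    ⟨hlm.trans hmq.to_reflTransGen, hq⟩
  obtain ⟨N, hN⟩ := hL.wellFounded l hl p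
    ⟨l, rfl, hp0 ▸ hlm.trans hmq.to_reflTransGen⟩ hpJ
  obtain ⟨n, hn, -, hpn, -⟩ := hpB N
  exact Bool.false_ne_true ((hN n hn).symm.trans hpn)

/-! ### Acceptable states -/

theorem IsAcceptable.consistent_union_reach {Δ Δg Δd : Set (Rule V D)}
    {Iin I : Set (DomLit V D)} {J : DomLit V D → Set (DomLit V D)}
    (h : IsAcceptable Δ Iin Δg Δd J I) : Consistent (I ∪ reach J (trueDefined Δd I)) := by
  rintro l (hl | hl) (hl' | hl')
  · exact h.isPartialStructure.1 l hl hl'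
  · refine h.consistent _ hl' ?_
    simpa [DomLit.compl] using hl
  · exact h.consistent _ hl hl'
  · exact h.justifies.consistent l hl hl'

end LazyGrounding

open LazyGrounding in
theorem mainTheorem1 {V : LazyGrounding.Vocabulary} {D : Type*}
    (T : V.Pred) (hT : V.arity T = 0)
    (Δ : Set (LazyGrounding.Rule V D))
    (hΔ : LazyGrounding.IsDefinition Δ) (hΔtotal : LazyGrounding.IsTotal Δ)
    (Iin : Set (LazyGrounding.DomLit V D)) (hIin : LazyGrounding.IsPartialStructure Iin)
    (Δg Δd : Set (LazyGrounding.Rule V D))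
    (J : LazyGrounding.DomLit V D → Set (LazyGrounding.DomLit V D))
    (I : Set (LazyGrounding.DomLit V D))
    (hstate : LazyGrounding.IsAcceptable Δ Iin Δg Δd J I)
    (hTI : LazyGrounding.pos (LazyGrounding.propAtom T hT) ∈ I)
    (hmodel : LazyGrounding.IsModel (LazyGrounding.voc Δg) Δg
      (LazyGrounding.restrict I (LazyGrounding.atomsOf D (LazyGrounding.voc Δg)))) :
    ∃ M : Set (LazyGrounding.DomLit V D),
      LazyGrounding.IsTheoryModel T hT Δ M ∧
      LazyGrounding.restrict I (LazyGrounding.atomsOf D (LazyGrounding.voc Δg)) ⊆ M := by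
  obtain ⟨O, hO, hCO⟩ := exists_isTwoValuedOn_of_consistent (openAtoms (Δg ∪ Δd))
    hstate.consistent_union_reach (hstate.isPartialStructure.2.trans Set.subset_union_left)
  have hclosed := wfClosed_wellFoundedModel (Δg ∪ Δd) O
  have hN := hstate.isTotal_union O hO
  have hNopen := restrict_openAtoms_wellFoundedModel hstate.isTotal_union hO
  set N := wellFoundedModel (Δg ∪ Δd) O
  have hreach : reach J (trueDefined Δd I) ⊆ N :=
    hstate.justifies.reach_subset_of_wfClosed
      (hstate.isDefinition_ground.union hstate.isDefinition_delayed hstate.disjoint) hclosed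
      hstate.isJustification fun m hm hmo => hclosed.1 (hCO ⟨Or.inr hm, hmo⟩)
  have hopenGround : restrict I (openAtoms Δg) ⊆ N := by
    rintro l ⟨hl, hlo⟩
    by_cases hd : l.atom ∈ definedAtoms Δd
    · exact hreach ⟨l, ⟨hl, hstate.isPartialStructure.1 l hl, hd⟩, .refl⟩
    · refine hclosed.1 (hCO ⟨Or.inl hl, ?_⟩)
      rintro ⟨r, hr | hr, h⟩
      · exact hlo ⟨r, hr, h⟩
      · exact hd ⟨r, hr, h⟩
  have hground : restrict I (atomsOf D (voc Δg)) ⊆ N := by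
    rw [hmodel.2]
    exact Set.sInter_subset_of_mem
      (hclosed.of_union_left hstate.disjoint fun l hl => hopenGround ⟨hl.1.1, hl.2⟩)
  have hNmodel : IsModel Set.univ (Δg ∪ Δd) N := ⟨hN, by rw [hNopen]⟩
  obtain ⟨M, ⟨hM, hNM⟩, -⟩ := hstate.equivalent.1 _
    (hNmodel.restrict Set.subset_union_right (Set.subset_univ (voc Δ ∪ voc (Δg ∪ Δd))))
  rw [Set.union_self] at hM
  have hMeq : restrict N (atomsOf D (voc Δ)) = M :=
    (hN.restrict (Set.subset_univ _)).eq_of_subset hM.1 fun l hl =>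
      hNM ⟨⟨hl.1, Or.inl hl.2⟩, hl.2⟩
  refine ⟨N, ⟨isModel_univ_of_restrict_voc hΔtotal hN (hMeq ▸ hM), ?_⟩, hground⟩
  by_cases hTg : propAtom T hT ∈ definedAtoms Δg
  · exact hground ⟨hTI, definedAtoms_subset_atomsOf_voc Δg hTg⟩
  · exact hopenGround ⟨hTI, hTg⟩
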